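/- Let $G$ be a finitely generated group and let $K \lhd G$ be a normal subgroup such that $K$ is torsion-free nilpotent of finite Prüfer rank (there is an $n$ such that every finitely generated subgroup of $K$ can be generated by at most $n$ elements) and $G/K$ is virtually abelian (so $G$ is an $\mathcal{M}$-group, as witnessed by $K$; such a group is residually finite). For a finite generating set $S$ of $G$ and $r \in \mathbb{R}$, let $B_{G,S}(r)$ be the set of products of at most $r$ elements of $S \cup S^{-1}$. For $e \neq g \in G$ put $D_G(g) = \min\{[G:N] \mid N \lhd G \text{ of finite index},\ g \notin N\}$, and let $$\mathrm{RF}_{G,S}(r) = \max\{D_G(g) \mid e \neq g \in B_{G,S}(r)\}$$ be the residual finiteness growth of $G$. For non-negative functions $f, h$ on $[1,\infty)$ write $f \preceq h$ if there is a constant $C > 0$ such that $f(r) \leq C\,h(Cr)$ for all real $r \geq \max\{1, 1/C\}$. Let $\gamma_1(K) = K$ and $\gamma_{i+1}(K) = [\gamma_i(K), K]$ denote the lower central series of $K$. Let $S$ be a finite generating set of $G$ and suppose that there are real constants $C_1, C_2 > 1$ and an integer $l > 1$ such that $$C_1^r \leq |B_{G,S}(C_2 r) \cap \gamma_l(K)|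 \quad \text{for all sufficiently large real } r.$$ Then $r^{l+1} \preceq \mathrm{RF}_{G,T}$ for every finite generating set $T$ of $G$. -/

import Mathlib

open scoped ENNReal

noncomputable section

namespace RFGrowth

variable {G : Type*} [Group G]

/-- Every finitely generated subgroup of `G` can be generated by at most `n` elements, that is,
the Prüfer rank of `G` is at most `n`. -/
def PruferRankLE (G : Type*) [Group G] (n : ℕ) : Prop :=
  ∀ A : Subgroup G, A.FG → ∃ s : Finset G, s.card ≤ n ∧ Subgroup.closure (s : Set G) = A

/-- `G` has an abelian subgroup of finite index. -/
def VirtuallyAbelian (G : Type*) [Group G] : Prop :=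
  ∃ A : Subgroup G, A.FiniteIndex ∧ ∀ a ∈ A, ∀ b ∈ A, a * b = b * a

/-- `G` is an `𝓜`-group, as witnessed by the normal subgroup `K`: the group `G` is finitely
generated, `K` is torsion-free nilpotent of finite Prüfer rank, and `G ⧸ K` is virtually
abelian. -/
structure IsMGroupWith (G : Type*) [Group G] (K : Subgroup G) [K.Normal] : Prop where
  fg : Group.FG G
  torsionFree : ∀ k : K, k ≠ 1 → ¬ IsOfFinOrder k
  nilpotent : Group.IsNilpotent K
  finitePruferRank : ∃ n : ℕ, PruferRankLE K n
  virtuallyAbelian : VirtuallyAbelian (G ⧸ K)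

/-- The `l`-th term `γ_l(K)` of the lower central series of `K`, as a subgroup of `G`, with the
convention `γ_1(K) = K` and `γ_{i+1}(K) = [γ_i(K), K]` (Mathlib's series starts at index `0`). -/
def gamma (K : Subgroup G) (l : ℕ) : Subgroup G :=
  K.lowerCentralSeries (l - 1)

/-- The ball of radius `r` around the identity for the word norm with respect to `S`: all products
of at most `r` elements of `S` and inverses of elements of `S`. -/
def wordBall (S : Finset G) (r : ℝ) : Set G :=
  {g | ∃ w : List G, (∀ x ∈ w, x ∈ S ∨ x⁻¹ ∈ S) ∧ (w.length : ℝ) ≤ r ∧ w.prod = g}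

/-- The divisibility function: the least index of a finite-index normal subgroup that does not
contain `g`. The value is `⊤` if no such subgroup exists, which does not happen for `g ≠ 1` in a
residually finite group. -/
def divisibility (g : G) : ℕ∞ :=
  ⨅ N : {N : Subgroup G // N.Normal ∧ N.FiniteIndex ∧ g ∉ N}, (N.1.index : ℕ∞)

/-- The residual finiteness growth with respect to `S`: the maximum of the divisibility function
over the non-trivial elements of the ball of radius `r`. -/
def rfGrowth (S : Finset G) (r : ℝ) : ℕ∞ :=
  ⨆ g : {g : G // g ∈ wordBall S r ∧ g ≠ 1}, divisibility g.1

/-- The relation `f ≼ g` between (extended) non-negative functions on `[1, ∞)`. -/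
def Dominated (f g : ℝ → ℝ≥0∞) : Prop :=
  ∃ C : ℝ, 0 < C ∧ ∀ r : ℝ, max 1 (1 / C) ≤ r → f r ≤ ENNReal.ofReal C * g (C * r)

end RFGrowth

end

/-! Pigeonhole on balls. Fix `m` and let `M` be the intersection of all normal subgroups of index
below `(m + 1) ^ (l + 1)`. In such a finite quotient let `H` be the image of `K`. If `p ^ k` divides
the exponent of `γ_l(H) / γ_{l+1}(H)`, it divides the order of each factor from `γ_2 / γ_3` down to
this one, and its square divides the order of `H / γ_2(H)`; so `p ^ k ≤ m` (`prime_pow_dvd_index`).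
Hence a power of `lcm(1, …, m)` depending only on the class kills the image of `γ_l(K)` in `G ⧸ M`.
Finite rank makes that image of size at most a fixed power of the lcm, which by Chebyshev is
exponential in `m`. The ball of radius `O(m)` has more elements in `γ_l(K)`, so two of them agree
modulo `M`, and their quotient has divisibility at least `(m + 1) ^ (l + 1)`. -/

namespace RFGrowth

open Subgroup
open scoped commutatorElement

/-! ### Commutators in class-two groups -/

section Commutator

variable {Q : Type*} [Group Q]

/-- In a group whose commutators are central, `h ↦ ⁅h, y⁆` is an endomorphism. -/
def commutatorHom (h : _root_.commutator Q ≤ center Q) (y : Q) : Q →* Q where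
  toFun x := ⁅x, y⁆
  map_one' := commutatorElement_one_left y
  map_mul' a b := by
    have hb : ⁅b, y⁆ ∈ center Q := h (commutator_mem_commutator (mem_top b) (mem_top y))
    have e : ⁅a * b, y⁆ = a * ⁅b, y⁆ * a⁻¹ * ⁅a, y⁆ := by
      simp only [commutatorElement_def]; group
    rw [e, (mem_center_iff.1 hb a), mul_inv_cancel_right, ← mem_center_iff.1 hb]

/-- If `⁅x, y⁆` is central then `⁅x ^ n, y⁆ = ⁅x, y⁆ ^ n`. -/
theorem commutatorElement_pow_left {x y : Q} (h : ⁅x, y⁆ ∈ center Q) (n : ℕ) :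
    ⁅x ^ n, y⁆ = ⁅x, y⁆ ^ n := by
  induction n with
  | zero => simp
  | succ n ih =>
    have e : ⁅x ^ (n + 1), y⁆ = x * ⁅x ^ n, y⁆ * x⁻¹ * ⁅x, y⁆ := by
      simp only [commutatorElement_def, pow_succ']; group
    have hn : ⁅x, y⁆ ^ n ∈ center Q := pow_mem h n
    rw [e, ih, mem_center_iff.1 hn x, mul_inv_cancel_right, pow_succ]

/-- The order of `⁅x, y⁆` divides the order of the image of `⁅·, y⁆`, and also the order of `y` in
the kernel modulo commutators; the two indices multiply. -/
theorem orderOf_commutatorElement_sq_dvd_index (h : _root_.commutator Q ≤ center Q) (x y : Q) :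
    orderOf ⁅x, y⁆ ^ 2 ∣ (_root_.commutator Q).index := by
  set φ := commutatorHom h y
  have hle : _root_.commutator Q ≤ φ.ker := fun z hz ↦ by
    rw [MonoidHom.mem_ker]
    exact commutatorElement_eq_one_iff_mul_comm.2 (mem_center_iff.1 (h hz) y).symm
  have hx : orderOf ⁅x, y⁆ ∣ φ.ker.index := by
    rw [index_ker]
    have := orderOf_dvd_natCard (φ.rangeRestrict x)
    rwa [← Subgroup.orderOf_coe] at this
  have hy : orderOf ⁅x, y⁆ ∣ (_root_.commutator Q).relIndex φ.ker := by
    have hyk : y ∈ φ.ker := commutatorElement_self y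
    let q : φ.ker ⧸ (_root_.commutator Q).subgroupOf φ.ker := QuotientGroup.mk ⟨y, hyk⟩
    refine dvd_trans (orderOf_dvd_of_pow_eq_one ?_) (orderOf_dvd_natCard q)
    have hq : q ^ orderOf q = 1 := pow_orderOf_eq_one q
    have hq' : y ^ orderOf q ∈ _root_.commutator Q := by
      rw [← QuotientGroup.mk_pow, QuotientGroup.eq_one_iff, mem_subgroupOf] at hq
      exact hq
    have hc : ⁅y, x⁆ ∈ center Q := h (commutator_mem_commutator (mem_top y) (mem_top x))
    rw [← commutatorElement_inv, inv_pow, ← commutatorElement_pow_left hc, inv_eq_one,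
      commutatorElement_eq_one_iff_mul_comm]
    exact (mem_center_iff.1 (h hq') x).symm
  rw [sq, ← relIndex_mul_index hle]
  exact mul_dvd_mul hy hx

end Commutator

/-! ### Exponents of lower central factors -/

section Factor

variable {H : Type*} [Group H]

local notation "Γ" => Subgroup.lowerCentralSeries (⊤ : Subgroup H)

/-- The exponent of the quotient of consecutive terms of the lower central series. -/
noncomputable def factorExponent (H : Type*) [Group H] (i : ℕ) : ℕ :=
  Monoid.exponent ((⊤ : Subgroup H).lowerCentralSeries i ⧸
    ((⊤ : Subgroup H).lowerCentralSeries (i + 1)).subgroupOf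
      ((⊤ : Subgroup H).lowerCentralSeries i))

theorem factorExponent_dvd_iff {i d : ℕ} :
    factorExponent H i ∣ d ↔ ∀ x ∈ Γ i, x ^ d ∈ Γ (i + 1) := by
  rw [factorExponent, Monoid.exponent_dvd_iff_forall_pow_eq_one]
  constructor
  · intro h x hx
    have := h (QuotientGroup.mk ⟨x, hx⟩)
    rw [← QuotientGroup.mk_pow, QuotientGroup.eq_one_iff, mem_subgroupOf] at this
    exact this
  · intro h q
    obtain ⟨x, rfl⟩ := QuotientGroup.mk_surjective q
    rw [← QuotientGroup.mk_pow, QuotientGroup.eq_one_iff, mem_subgroupOf]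
    exact h x x.2

theorem mk_mem_center_of_mem_lowerCentralSeries {i : ℕ} {x : H} (hx : x ∈ Γ i) :
    (x : H ⧸ Γ (i + 1)) ∈ center (H ⧸ Γ (i + 1)) := by
  rw [mem_center_iff]
  intro q
  obtain ⟨y, rfl⟩ := QuotientGroup.mk_surjective q
  have : ((⁅x, y⁆ : H) : H ⧸ Γ (i + 1)) = 1 :=
    (QuotientGroup.eq_one_iff _).2 (commutator_mem_commutator hx (mem_top y))
  exact (commutatorElement_eq_one_iff_mul_comm.1 this).symm

/-- The factor is abelian, so it is enough to test its generators. -/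
theorem pow_mem_lowerCentralSeries_of_commutator {i d : ℕ}
    (h : ∀ x ∈ Γ i, ∀ y, ⁅x, y⁆ ^ d ∈ Γ (i + 2)) :
    ∀ z ∈ Γ (i + 1), z ^ d ∈ Γ (i + 2) := by
  intro z hz
  let S : Subgroup H :=
    { carrier := {z | z ∈ Γ (i + 1) ∧ z ^ d ∈ Γ (i + 2)}
      one_mem' := ⟨one_mem _, by simp⟩
      mul_mem' := by
        rintro a b ⟨ha, ha'⟩ ⟨hb, hb'⟩
        refine ⟨mul_mem ha hb, ?_⟩
        rw [← QuotientGroup.eq_one_iff] at ha' hb' ⊢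
        have hc : Commute (a : H ⧸ Γ (i + 2)) b :=
          mem_center_iff.1 (mk_mem_center_of_mem_lowerCentralSeries hb) a
        rw [QuotientGroup.mk_pow, QuotientGroup.mk_mul, hc.mul_pow, ← QuotientGroup.mk_pow,
          ← QuotientGroup.mk_pow, ha', hb', one_mul]
      inv_mem' := by
        rintro a ⟨ha, ha'⟩
        exact ⟨inv_mem ha, by rw [inv_pow]; exact inv_mem ha'⟩ }
  have : Γ (i + 1) ≤ S := by
    rw [Subgroup.lowerCentralSeries_succ, commutator_le]
    exact fun x hx y _ ↦ ⟨commutator_mem_commutator hx (mem_top y), h x hx y⟩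
  exact (this hz).2

/-- Modulo `Γ (i + 2)`, `⁅x, y⁆ ^ d = ⁅x ^ d, y⁆`, which is trivial once `x ^ d ∈ Γ (i + 1)`. -/
theorem factorExponent_succ_dvd (i : ℕ) : factorExponent H (i + 1) ∣ factorExponent H i := by
  rw [factorExponent_dvd_iff]
  refine pow_mem_lowerCentralSeries_of_commutator fun x hx y ↦ ?_
  have hxd := factorExponent_dvd_iff.1 dvd_rfl x hx
  have hc : ⁅(x : H ⧸ Γ (i + 2)), (y : H ⧸ Γ (i + 2))⁆ ∈ center (H ⧸ Γ (i + 2)) :=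
    mk_mem_center_of_mem_lowerCentralSeries (commutator_mem_commutator hx (mem_top y))
  rw [← QuotientGroup.eq_one_iff]
  change ⁅(x : H ⧸ Γ (i + 2)), (y : H ⧸ Γ (i + 2))⁆ ^ _ = 1
  rw [← commutatorElement_pow_left hc]
  exact (QuotientGroup.eq_one_iff _).2 (commutator_mem_commutator hxd (mem_top y))

theorem factorExponent_dvd_of_le {i j : ℕ} (h : i ≤ j) :
    factorExponent H j ∣ factorExponent H i := by
  induction h with
  | refl => exact dvd_rfl
  | step _ ih => exact (factorExponent_succ_dvd _).trans ih

theorem factorExponent_dvd_relIndex (i : ℕ) :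
    factorExponent H i ∣ (Γ (i + 1)).relIndex (Γ i) :=
  Group.exponent_dvd_nat_card

theorem prime_pow_sq_dvd_index [Finite H] {p k : ℕ} (hp : p.Prime)
    (h : p ^ k ∣ factorExponent H 1) : (p ^ k) ^ 2 ∣ (Γ 1).index := by
  rcases Nat.eq_zero_or_pos k with rfl | hk
  · simp
  let Q := H ⧸ Γ 2
  have hcomm : (Γ 1).map (QuotientGroup.mk' (Γ 2)) = _root_.commutator Q := by
    rw [map_lowerCentralSeries, map_top_of_surjective _ (QuotientGroup.mk'_surjective _),
      top_lowerCentralSeries_one]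
  have hcen : _root_.commutator Q ≤ center Q := by
    rw [← hcomm]
    rintro _ ⟨x, hx, rfl⟩
    exact mk_mem_center_of_mem_lowerCentralSeries hx
  obtain ⟨x, y, hxy⟩ : ∃ x y : Q, p ^ k ∣ orderOf ⁅x, y⁆ := by
    by_contra! hcon
    have hcard : Nat.card Q ≠ 0 := Nat.card_pos.ne'
    -- Otherwise every commutator has `p`-part at most `p ^ (k - 1)`, and so has the exponent.
    have hd : factorExponent H 1 ∣ p ^ (k - 1) * ordCompl[p] (Nat.card Q) := by
      rw [factorExponent_dvd_iff]
      refine pow_mem_lowerCentralSeries_of_commutator fun x _ y ↦ ?_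
      rw [← QuotientGroup.eq_one_iff]
      change ⁅(x : Q), (y : Q)⁆ ^ _ = 1
      rw [← orderOf_dvd_iff_pow_eq_one]
      have hn : orderOf ⁅(x : Q), (y : Q)⁆ ≠ 0 := (orderOf_pos _).ne'
      rw [← Nat.ordProj_mul_ordCompl_eq_self (orderOf ⁅(x : Q), (y : Q)⁆) p]
      refine mul_dvd_mul (pow_dvd_pow p ?_)
        (Nat.ordCompl_dvd_ordCompl_of_dvd (orderOf_dvd_natCard _) p)
      have := mt (hp.pow_dvd_iff_le_factorization hn).2 (hcon (x : Q) (y : Q))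
      omega
    have h2 : p ^ k ∣ p ^ (k - 1) :=
      (Nat.Coprime.pow_left k (Nat.coprime_ordCompl hp hcard)).dvd_of_dvd_mul_right (h.trans hd)
    have := (Nat.pow_dvd_pow_iff_le_right hp.one_lt).1 h2
    omega
  refine (pow_dvd_pow_of_dvd hxy 2).trans ?_
  refine (orderOf_commutatorElement_sq_dvd_index hcen x y).trans (dvd_of_eq ?_)
  rw [← hcomm, index_map_eq _ (QuotientGroup.mk'_surjective _)]
  rw [QuotientGroup.ker_mk']
  exact Subgroup.lowerCentralSeries_antitone _ (by norm_num)

/-- The abelianization contributes two factors `p ^ k`, and each of the next `j + 1` quotients one.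
-/
theorem prime_pow_dvd_index [Finite H] {p k j : ℕ} (hp : p.Prime)
    (h : p ^ k ∣ factorExponent H (j + 1)) : (p ^ k) ^ (j + 3) ∣ (Γ (j + 2)).index := by
  have key : ∀ i ≤ j + 1, (p ^ k) ^ (i + 2) ∣ (Γ (i + 1)).index := by
    intro i hi
    induction i with
    | zero => exact prime_pow_sq_dvd_index hp (h.trans (factorExponent_dvd_of_le (by omega)))
    | succ i ih =>
      rw [← relIndex_mul_index (Subgroup.lowerCentralSeries_antitone _ (Nat.le_succ (i + 1))),
        show i + 1 + 2 = i + 2 + 1 by ring, pow_succ']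
      exact mul_dvd_mul ((h.trans (factorExponent_dvd_of_le hi)).trans
        (factorExponent_dvd_relIndex _)) (ih (by omega))
  exact key (j + 1) le_rfl

theorem factorExponent_dvd_lcmUpto [Finite H] {j m : ℕ} (h : Nat.card H < (m + 1) ^ (j + 3)) :
    factorExponent H (j + 1) ∣ Nat.lcmUpto m := by
  refine (Nat.dvd_iff_prime_pow_dvd_dvd _ _).2 fun p k hp hpk ↦ ?_
  have h1 : (p ^ k) ^ (j + 3) ≤ Nat.card H :=
    Nat.le_of_dvd Nat.card_pos ((prime_pow_dvd_index hp hpk).trans (index_dvd_card _))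
  have h2 : p ^ k < m + 1 := lt_of_pow_lt_pow_left₀ _ (Nat.zero_le _) (h1.trans_lt h)
  exact Finset.dvd_lcm (f := id)
    (Finset.mem_Icc.2 ⟨pow_pos hp.pos k, Nat.lt_succ_iff.1 h2⟩)

theorem pow_eq_one_of_mem_lowerCentralSeries [Finite H] {j m c : ℕ}
    (h : Nat.card H < (m + 1) ^ (j + 3)) (hc : Γ c = ⊥) {x : H} (hx : x ∈ Γ (j + 1)) :
    x ^ Nat.lcmUpto m ^ c = 1 := by
  -- Each further power of the lcm moves one term down the series.
  have key : ∀ i, x ^ Nat.lcmUpto m ^ i ∈ Γ (j + 1 + i) := by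
    intro i
    induction i with
    | zero => simpa using hx
    | succ i ih =>
      rw [pow_succ, pow_mul]
      exact factorExponent_dvd_iff.1 ((factorExponent_dvd_of_le (Nat.le_add_right _ _)).trans
        (factorExponent_dvd_lcmUpto h)) _ ih
  have := Subgroup.lowerCentralSeries_antitone _ (Nat.le_add_left c (j + 1)) (key c)
  rwa [hc, mem_bot] at this

end Factor

/-! ### Orders of nilpotent groups of bounded rank and exponent -/

section Prufer

variable {A B : Type*} [Group A] [Group B]

theorem PruferRankLE.of_injective {n : ℕ} (h : PruferRankLE B n) (f : A →* B)
    (hf : Function.Injective f) : PruferRankLE A n := by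
  classical
  intro D hD
  obtain ⟨s, hs, hs'⟩ := h (D.map f) (by
    obtain ⟨t, rfl⟩ := hD
    exact ⟨t.image f, by rw [Finset.coe_image, MonoidHom.map_closure]⟩)
  have hsub : (s : Set B) ⊆ Set.range f := fun b hb ↦ by
    obtain ⟨a, -, ha⟩ := (hs' ▸ subset_closure hb : b ∈ D.map f)
    exact ⟨a, ha⟩
  refine ⟨s.preimage f hf.injOn,
    (Finset.card_le_card_of_injOn f (fun a ha ↦ by simpa using ha) hf.injOn).trans hs, ?_⟩
  apply map_injective hf
  rw [MonoidHom.map_closure, Finset.coe_preimage, Set.image_preimage_eq_of_subset hsub, hs']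

theorem PruferRankLE.of_surjective {n : ℕ} (h : PruferRankLE A n) (f : A →* B)
    (hf : Function.Surjective f) : PruferRankLE B n := by
  classical
  rintro D ⟨t, rfl⟩
  obtain ⟨t', ht'⟩ : ∃ t' : Finset A, t'.image f = t :=
    ⟨t.image (Function.surjInv hf), by
      rw [Finset.image_image]; simp [Function.comp_def, Function.surjInv_eq]⟩
  obtain ⟨s, hs, hs'⟩ := h (closure (t' : Set A)) ⟨t', rfl⟩
  refine ⟨s.image f, Finset.card_image_le.trans hs, ?_⟩
  rw [Finset.coe_image, ← MonoidHom.map_closure, hs', MonoidHom.map_closure, ← Finset.coe_image,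
    ht']

/-- A commutative group of exponent dividing `e` generated by `s` has at most `e ^ #s` elements. -/
theorem finite_and_card_le_of_closure_eq_top {A : Type*} [CommGroup A] {e : ℕ} (he : 0 < e)
    (hA : ∀ a : A, a ^ e = 1) (s : Finset A) :
    Finite (closure (s : Set A)) ∧ Nat.card (closure (s : Set A)) ≤ e ^ s.card := by
  classical
  have : NeZero e := ⟨he.ne'⟩
  let f : (s → Fin e) → A := fun v ↦ ∏ a : s, (a : A) ^ (v a : ℕ)
  have hsub : (closure (s : Set A) : Set A) ⊆ Set.range f := by
    intro x hx
    induction hx using closure_induction with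
    | mem x hx =>
      -- In `Fin 1` one has `1 = 0`, so the indicator vector below needs `1 < e`.
      by_cases h1 : e = 1
      · refine ⟨0, ?_⟩
        have := hA x
        subst h1
        simpa [f] using this.symm
      refine ⟨Pi.single ⟨x, hx⟩ 1, ?_⟩
      simp only [f]
      rw [Finset.prod_eq_single ⟨x, hx⟩]
      · rw [Pi.single_eq_same, Fin.val_one', Nat.mod_eq_of_lt (by omega), pow_one]
      · intro b _ hb
        simp [Pi.single_eq_of_ne hb]
      · simp
    | one => exact ⟨0, by simp [f]⟩
    | mul x y _ _ hx hy =>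
      obtain ⟨v, rfl⟩ := hx
      obtain ⟨w, rfl⟩ := hy
      refine ⟨v + w, ?_⟩
      simp only [f]
      rw [← Finset.prod_mul_distrib]
      refine Finset.prod_congr rfl fun a _ ↦ ?_
      rw [Pi.add_apply, Fin.val_add, ← pow_add, ← pow_eq_pow_mod _ (hA a)]
    | inv x _ hx =>
      obtain ⟨v, rfl⟩ := hx
      refine ⟨-v, ?_⟩
      simp only [f]
      rw [← Finset.prod_inv_distrib]
      refine Finset.prod_congr rfl fun a _ ↦ ?_
      rw [eq_inv_iff_mul_eq_one, ← pow_add, pow_eq_pow_mod _ (hA a), ← Fin.val_add, Pi.neg_apply,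
        neg_add_cancel]
      simp
  have hfin : (Set.range f).Finite := Set.finite_range f
  refine ⟨(hfin.subset hsub).to_subtype, ?_⟩
  have h1 : Nat.card (closure (s : Set A)) ≤ Nat.card (Set.range f) := Nat.card_mono hfin hsub
  refine h1.trans ((Finite.card_range_le f).trans (le_of_eq ?_))
  simp

theorem finite_and_card_le_of_comm {A : Type*} [CommGroup A] {e n : ℕ} (he : 0 < e)
    (hA : ∀ a : A, a ^ e = 1) (hn : PruferRankLE A n) : Finite A ∧ Nat.card A ≤ e ^ n := by
  -- Bounding finite subsets also yields finiteness, which `Nat.card` alone would not.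
  have key : ∀ t : Finset A, t.card ≤ e ^ n := by
    intro t
    obtain ⟨s, hs, hs'⟩ := hn (closure (t : Set A)) ⟨t, rfl⟩
    obtain ⟨h1, h2⟩ := finite_and_card_le_of_closure_eq_top he hA s
    rw [hs'] at h1 h2
    have h3 : Nat.card (t : Set A) ≤ Nat.card (closure (t : Set A)) :=
      Nat.card_mono (Set.toFinite _) subset_closure
    rw [Nat.card_coe_set_eq, Set.ncard_coe_finset] at h3
    exact h3.trans (h2.trans (Nat.pow_le_pow_right he hs))
  have hfin : Finite A := by
    by_contra hinf
    rw [not_finite_iff_infinite] at hinf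
    obtain ⟨t, ht⟩ := Infinite.exists_subset_card_eq A (e ^ n + 1)
    have := key t
    omega
  refine ⟨hfin, ?_⟩
  have := Fintype.ofFinite A
  rw [Nat.card_eq_fintype_card]
  exact key Finset.univ

theorem finite_and_card_le_of_nilpotent {e n : ℕ} (he : 0 < e) (c : ℕ) :
    ∀ (A : Type*) [Group A] [Group.IsNilpotent A], Group.nilpotencyClass A ≤ c →
      (∀ a : A, a ^ e = 1) → PruferRankLE A n → Finite A ∧ Nat.card A ≤ (e ^ n) ^ c := by
  induction c with
  | zero =>
    intro A _ _ hc _ _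
    have := Group.nilpotencyClass_zero_iff_subsingleton.1 (Nat.le_zero.1 hc)
    exact ⟨inferInstance, by simp⟩
  | succ c ih =>
    intro A _ _ hc hA hn
    let _ : CommGroup (center A) :=
      { (inferInstance : Group (center A)) with
        mul_comm := fun a b ↦ Subtype.ext (mem_center_iff.1 b.2 a) }
    obtain ⟨f1, c1⟩ := finite_and_card_le_of_comm he (A := center A)
      (fun a ↦ Subtype.ext (hA a)) (hn.of_injective _ (center A).subtype_injective)
    obtain ⟨f2, c2⟩ := ih (A ⧸ center A)
      (by rw [Group.nilpotencyClass_quotient_center]; omega)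
      (fun q ↦ by
        obtain ⟨a, rfl⟩ := QuotientGroup.mk_surjective q
        rw [← QuotientGroup.mk_pow, hA, QuotientGroup.mk_one])
      (hn.of_surjective _ (QuotientGroup.mk'_surjective (center A)))
    have hcard := card_eq_card_quotient_mul_card_subgroup (center A)
    refine ⟨Nat.finite_of_card_ne_zero ?_, ?_⟩
    · rw [hcard]
      exact mul_ne_zero Nat.card_pos.ne' Nat.card_pos.ne'
    · rw [hcard, pow_succ]
      exact Nat.mul_le_mul c2 c1

end Prufer

/-! ### Word balls and change of generators -/

section WordBall

variable {G : Type*} [Group G]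

theorem mul_mem_wordBall {S : Finset G} {a b : ℝ} {g h : G} (hg : g ∈ wordBall S a)
    (hh : h ∈ wordBall S b) : g * h ∈ wordBall S (a + b) := by
  obtain ⟨v, hv, hva, rfl⟩ := hg
  obtain ⟨w, hw, hwb, rfl⟩ := hh
  refine ⟨v ++ w, fun x hx ↦ ?_, ?_, List.prod_append⟩
  · rcases List.mem_append.1 hx with hx | hx
    exacts [hv x hx, hw x hx]
  · rw [List.length_append]
    push_cast
    linarith

theorem inv_mem_wordBall {S : Finset G} {a : ℝ} {g : G} (hg : g ∈ wordBall S a) :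
    g⁻¹ ∈ wordBall S a := by
  obtain ⟨v, hv, hva, rfl⟩ := hg
  refine ⟨(v.map (·⁻¹)).reverse, fun x hx ↦ ?_, by simpa using hva, (List.prod_inv_reverse v).symm⟩
  obtain ⟨y, hy, rfl⟩ := List.mem_map.1 (List.mem_reverse.1 hx)
  rw [inv_inv]
  exact (hv y hy).symm

theorem wordBall_mono {S : Finset G} {a b : ℝ} (h : a ≤ b) : wordBall S a ⊆ wordBall S b := by
  rintro _ ⟨v, hv, hva, rfl⟩
  exact ⟨v, hv, hva.trans h, rfl⟩

theorem exists_wordBall_subset (S T : Finset G) (hT : closure (T : Set G) = ⊤) :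
    ∃ κ : ℝ, 1 ≤ κ ∧ ∀ r, wordBall S r ⊆ wordBall T (κ * r) := by
  have hex : ∀ g : G, ∃ k : ℕ, g ∈ wordBall T k := fun g ↦ by
    have hg : g ∈ (closure (T : Set G)).toSubmonoid := by simp [hT]
    rw [closure_toSubmonoid] at hg
    obtain ⟨w, hw, rfl⟩ := Submonoid.exists_list_of_mem_closure hg
    exact ⟨w.length, w, hw, le_rfl, rfl⟩
  choose len hlen using hex
  -- The summand `1` ensures `1 ≤ κ` even for empty `S`.
  let κ : ℕ := 1 + ∑ s ∈ S, len s
  have hκ : ∀ s ∈ S, s ∈ wordBall T κ := fun s hs ↦ by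
    refine wordBall_mono ?_ (hlen s)
    have := Finset.single_le_sum (f := len) (fun _ _ ↦ Nat.zero_le _) hs
    exact_mod_cast this.trans (Nat.le_add_left _ 1)
  refine ⟨κ, by exact_mod_cast Nat.le_add_right 1 _, ?_⟩
  rintro r _ ⟨w, hw, hwr, rfl⟩
  have key : w.prod ∈ wordBall T (κ * w.length) := by
    clear hwr
    induction w with
    | nil => exact ⟨[], by simp, by simp, rfl⟩
    | cons x w ih =>
      have hx : x ∈ wordBall T κ := by
        rcases hw x (by simp) with h | h
        · exact hκ x h
        · simpa using inv_mem_wordBall (hκ _ h)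
      rw [List.prod_cons, List.length_cons]
      refine wordBall_mono (le_of_eq ?_)
        (mul_mem_wordBall hx (ih fun y hy ↦ hw y (List.mem_cons_of_mem _ hy)))
      push_cast
      ring
  exact wordBall_mono (by gcongr) key

end WordBall

/-! ### Intersections of small-index normal subgroups -/

section Quotient

variable {G : Type*} [Group G]

/-- The intersection of all normal subgroups of `G` of finite index less than `b`. -/
def smallIndexCore (G : Type*) [Group G] (b : ℕ) : Subgroup G :=
  sInf {N | N.Normal ∧ N.FiniteIndex ∧ N.index < b}

instance smallIndexCore_normal (b : ℕ) : (smallIndexCore G b).Normal :=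
  ⟨fun x hx g ↦ mem_sInf.2 fun N hN ↦ hN.1.conj_mem x (mem_sInf.1 hx N hN) g⟩

/-- The exponent does not depend on `N`, so the bound passes to the intersection. -/
theorem pow_mem_smallIndexCore (K : Subgroup G) {j m c : ℕ}
    (hc : K.lowerCentralSeries c = ⊥) {x : G} (hx : x ∈ K.lowerCentralSeries (j + 1)) :
    x ^ Nat.lcmUpto m ^ c ∈ smallIndexCore G ((m + 1) ^ (j + 3)) := by
  refine mem_sInf.2 fun N ⟨hN, hfin, hind⟩ ↦ ?_
  let H := K.map (QuotientGroup.mk' N)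
  have hmap : ∀ i, ((⊤ : Subgroup H).lowerCentralSeries i).map H.subtype =
      (K.lowerCentralSeries i).map (QuotientGroup.mk' N) := fun i ↦ by
    rw [top_subtype_lowerCentralSeries, map_lowerCentralSeries]
  obtain ⟨y, hy, hyx⟩ : QuotientGroup.mk' N x ∈
      ((⊤ : Subgroup H).lowerCentralSeries (j + 1)).map H.subtype := by
    rw [hmap]
    exact ⟨x, hx, rfl⟩
  have hbot : (⊤ : Subgroup H).lowerCentralSeries c = ⊥ := by
    rw [← map_subtype_inj, hmap, hc, Subgroup.map_bot, Subgroup.map_bot]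
  have hcard : Nat.card H < (m + 1) ^ (j + 3) :=
    (card_le_card_group H).trans_lt hind
  have := congrArg H.subtype (pow_eq_one_of_mem_lowerCentralSeries hcard hbot hy)
  rw [map_pow, hyx, map_one, ← map_pow] at this
  exact (QuotientGroup.eq_one_iff _).1 this

theorem nilpotent_and_nilpotencyClass_le_of_injective {A B : Type*} [Group A] [Group B]
    [Group.IsNilpotent B] (f : A →* B) (hf : Function.Injective f) :
    ∃ _ : Group.IsNilpotent A, Group.nilpotencyClass A ≤ Group.nilpotencyClass B := by
  have h : (⊤ : Subgroup A).lowerCentralSeries (Group.nilpotencyClass B) = ⊥ := by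
    apply map_injective hf
    rw [Subgroup.map_bot, eq_bot_iff, map_lowerCentralSeries,
      ← Subgroup.lowerCentralSeries_nilpotencyClass]
    exact lowerCentralSeries_mono _ le_top
  have hA := Subgroup.nilpotent_iff_lowerCentralSeries.2 ⟨_, h⟩
  exact ⟨hA, Subgroup.lowerCentralSeries_eq_bot_iff_nilpotencyClass_le.1 h⟩

theorem finite_and_ncard_map_smallIndexCore_le (K : Subgroup G) [Group.IsNilpotent K] {n : ℕ}
    (hn : PruferRankLE K n) (j m : ℕ) :
    let c := Group.nilpotencyClass K
    let M := smallIndexCore G ((m + 1) ^ (j + 3))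
    let X : Set (G ⧸ M) := (K.lowerCentralSeries (j + 1)).map (QuotientGroup.mk' M)
    X.Finite ∧ X.ncard ≤ Nat.lcmUpto m ^ (c * n * c) := by
  intro c M X
  let A := K.lowerCentralSeries (j + 1)
  let B := A.map (QuotientGroup.mk' M)
  have hcK : K.lowerCentralSeries c = ⊥ := by
    rw [← top_subtype_lowerCentralSeries, Subgroup.lowerCentralSeries_nilpotencyClass,
      Subgroup.map_bot]
  have hinj : Function.Injective (inclusion (K.lowerCentralSeries_le_self (j + 1))) :=
    inclusion_injective _
  obtain ⟨_, hAc⟩ := nilpotent_and_nilpotencyClass_le_of_injective _ hinj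
  let f : A →* B := (QuotientGroup.mk' M).subgroupMap A
  have hf : Function.Surjective f := MonoidHom.subgroupMap_surjective _ _
  have : Group.IsNilpotent B := Group.nilpotent_of_surjective f hf
  obtain ⟨h1, h2⟩ := finite_and_card_le_of_nilpotent (e := Nat.lcmUpto m ^ c)
    (pow_pos (Nat.lcmUpto_pos m) c) c B
    ((Group.nilpotencyClass_le_of_surjective f hf).trans hAc)
    (by
      rintro ⟨_, x, hx, rfl⟩
      exact Subtype.ext ((QuotientGroup.eq_one_iff _).2 (pow_mem_smallIndexCore K hcK hx)))
    ((hn.of_injective _ hinj).of_surjective f hf)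
  refine ⟨(Set.toFinite (B : Set (G ⧸ M)) :), ?_⟩
  rw [← pow_mul, ← pow_mul] at h2
  rwa [← Nat.card_coe_set_eq, mul_assoc]

theorem le_divisibility_of_mem_smallIndexCore {b : ℕ} {g : G} (hg : g ∈ smallIndexCore G b) :
    (b : ℕ∞) ≤ divisibility g := by
  refine le_iInf fun ⟨N, hN, hfin, hgN⟩ ↦ ?_
  by_contra! h
  exact hgN (mem_sInf.1 hg N ⟨hN, hfin, by exact_mod_cast h⟩)

end Quotient

/-! ### Chebyshev bound and pigeonhole -/

theorem lcmUpto_floor_le_exp {r : ℝ} (hr : 0 ≤ r) :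
    (Nat.lcmUpto ⌊r⌋₊ : ℝ) ≤ Real.exp ((Real.log 4 + 4) * r) := by
  have hpos : (0 : ℝ) < Nat.lcmUpto ⌊r⌋₊ := by exact_mod_cast Nat.lcmUpto_pos _
  rw [← Real.log_le_iff_le_exp hpos, ← Chebyshev.psi_eq_log_lcmUpto,
    ← Chebyshev.psi_eq_psi_coe_floor]
  exact Chebyshev.psi_le_const_mul_self hr

theorem exists_mem_wordBall_le_divisibility {G : Type*} [Group G] (K : Subgroup G)
    [Group.IsNilpotent K] {n : ℕ} (hn : PruferRankLE K n) (S : Finset G) (j : ℕ) {C₁ C₂ : ℝ}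
    (hC₁ : 1 < C₁)
    (hgrowth : ∀ᶠ r : ℝ in Filter.atTop,
      C₁ ^ r ≤ ((wordBall S (C₂ * r) ∩ (K.lowerCentralSeries (j + 1) : Set G)).ncard : ℝ)) :
    ∃ D : ℝ, 1 ≤ D ∧ ∀ r : ℝ, 1 ≤ r → ∃ g ∈ wordBall S (2 * (C₂ * (D * r))), g ≠ 1 ∧
      (((⌊r⌋₊ + 1) ^ (j + 3) : ℕ) : ℕ∞) ≤ divisibility g := by
  obtain ⟨R, hR⟩ := Filter.eventually_atTop.1 hgrowth
  set c := Group.nilpotencyClass K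
  set a : ℝ := (Real.log 4 + 4) * (c * n * c : ℕ)
  have hlog : 0 < Real.log C₁ := Real.log_pos hC₁
  -- `D ≥ R` puts `D * r` in the range of the growth hypothesis; the other term makes `C₁ ^ (D * r)`
  -- exceed the image size `exp (a * r)`.
  let D : ℝ := max (max 1 R) (a / Real.log C₁ + 1)
  have hD1 : 1 ≤ D := (le_max_left 1 R).trans (le_max_left _ _)
  have hDR : R ≤ D := (le_max_right 1 R).trans (le_max_left _ _)
  have hDa : a < D * Real.log C₁ := by
    rw [← div_lt_iff₀ hlog]
    exact (lt_add_one _).trans_le (le_max_right _ _)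
  refine ⟨D, hD1, fun r hr ↦ ?_⟩
  have hr0 : 0 < r := by linarith
  obtain ⟨hfin, hcard⟩ := finite_and_ncard_map_smallIndexCore_le K hn j ⌊r⌋₊
  set M := smallIndexCore G ((⌊r⌋₊ + 1) ^ (j + 3))
  have hbig := hR (D * r) (hDR.trans (le_mul_of_one_le_right (by linarith) hr))
  have hexp : ((Nat.lcmUpto ⌊r⌋₊ ^ (c * n * c) : ℕ) : ℝ) < C₁ ^ (D * r) := by
    rw [Real.rpow_def_of_pos (by linarith), Nat.cast_pow]
    calc (Nat.lcmUpto ⌊r⌋₊ : ℝ) ^ (c * n * c)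
        ≤ Real.exp ((Real.log 4 + 4) * r) ^ (c * n * c) := by
          gcongr
          exact lcmUpto_floor_le_exp hr0.le
      _ = Real.exp (a * r) := by
          rw [← Real.exp_nat_mul]
          congr 1
          ring
      _ < Real.exp (Real.log C₁ * (D * r)) := by
          rw [Real.exp_lt_exp]
          calc a * r < D * Real.log C₁ * r := by gcongr
            _ = _ := by ring
  have hlt : Set.ncard ((K.lowerCentralSeries (j + 1)).map (QuotientGroup.mk' M) : Set (G ⧸ M)) <
      (wordBall S (C₂ * (D * r)) ∩ (K.lowerCentralSeries (j + 1) : Set G)).ncard := by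
    refine hcard.trans_lt ?_
    exact_mod_cast hexp.trans_le hbig
  obtain ⟨x, hx, y, hy, hxy, he⟩ := Set.exists_ne_map_eq_of_ncard_lt_of_maps_to hlt
    (f := QuotientGroup.mk' M) (fun z hz ↦ ⟨z, hz.2, rfl⟩) hfin
  refine ⟨x⁻¹ * y, ?_, ?_, ?_⟩
  · rw [two_mul]
    exact mul_mem_wordBall (inv_mem_wordBall hx.1) hy.1
  · exact fun h ↦ hxy (inv_mul_eq_one.1 h)
  · exact le_divisibility_of_mem_smallIndexCore (QuotientGroup.eq.1 he)

end RFGrowth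

theorem mainTheorem4 {G : Type*} [Group G] (K : Subgroup G) [K.Normal]
    (hG : RFGrowth.IsMGroupWith G K)
    (S : Finset G) (hS : Subgroup.closure (S : Set G) = ⊤)
    (l : ℕ) (hl : 1 < l) (C₁ C₂ : ℝ) (hC₁ : 1 < C₁) (hC₂ : 1 < C₂)
    (hgrowth : ∀ᶠ r : ℝ in Filter.atTop,
      C₁ ^ r ≤
        ((RFGrowth.wordBall S (C₂ * r) ∩ (RFGrowth.gamma K l : Set G)).ncard : ℝ))
    (T : Finset G) (hT : Subgroup.closure (T : Set G) = ⊤) :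
    RFGrowth.Dominated (fun r => ENNReal.ofReal (r ^ (l + 1)))
      (fun r => ((RFGrowth.rfGrowth T r : ℕ∞) : ENNReal)) := by
  -- `gamma K (j + 2)` is `K.lowerCentralSeries (j + 1)`, and `j + 3 = l + 1`.
  obtain ⟨j, rfl⟩ : ∃ j, l = j + 2 := ⟨l - 2, by omega⟩
  have := hG.nilpotent
  obtain ⟨n, hn⟩ := hG.finitePruferRank
  obtain ⟨D, hD, h⟩ := RFGrowth.exists_mem_wordBall_le_divisibility K hn S j hC₁ hgrowth
  obtain ⟨κ, hκ, hST⟩ := RFGrowth.exists_wordBall_subset S T hT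
  have hC : 1 ≤ κ * (2 * (C₂ * D)) :=
    one_le_mul_of_one_le_of_one_le hκ (by
      have := one_le_mul_of_one_le_of_one_le hC₂.le hD
      linarith)
  refine ⟨κ * (2 * (C₂ * D)), by linarith, fun r hr ↦ ?_⟩
  have hr1 : 1 ≤ r := (le_max_left _ _).trans hr
  obtain ⟨g, hg, hg1, hdiv⟩ := h r hr1
  have hgT : g ∈ RFGrowth.wordBall T (κ * (2 * (C₂ * D)) * r) := by
    rw [show κ * (2 * (C₂ * D)) * r = κ * (2 * (C₂ * (D * r))) by ring]
    exact hST _ hg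
  have hle : (((⌊r⌋₊ + 1) ^ (j + 3) : ℕ) : ℕ∞) ≤
      RFGrowth.rfGrowth T (κ * (2 * (C₂ * D)) * r) :=
    hdiv.trans (le_iSup (fun g : {g : G // g ∈ RFGrowth.wordBall T (κ * (2 * (C₂ * D)) * r) ∧
      g ≠ 1} ↦ RFGrowth.divisibility g.1) ⟨g, hgT, hg1⟩)
  calc ENNReal.ofReal (r ^ (j + 2 + 1))
      ≤ (((⌊r⌋₊ + 1) ^ (j + 3) : ℕ) : ENNReal) := by
        rw [← ENNReal.ofReal_natCast]
        apply ENNReal.ofReal_le_ofReal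
        push_cast
        gcongr
        exact (Nat.lt_floor_add_one r).le
    _ ≤ ((RFGrowth.rfGrowth T (κ * (2 * (C₂ * D)) * r) : ℕ∞) : ENNReal) := by
        rw [← ENat.toENNReal_coe]
        exact ENat.toENNReal_le.2 hle
    _ ≤ _ := le_mul_of_one_le_left zero_le (ENNReal.one_le_ofReal.2 hC)
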